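/- For all Lebesgue measurable functions $f,g:\mathbb{R}\to\{-1,1\}$ the double integrals below converge absolutely and $$\int_{\mathbb{R}}\int_{\mathbb{R}} f(x)g(y)\,e^{-(x^2+y^2)/2}\sin(xy)\,dx\,dy\;\le\;\int_{\mathbb{R}}\int_{\mathbb{R}} \operatorname{sign}(x)\operatorname{sign}(y)\,e^{-(x^2+y^2)/2}\sin(xy)\,dx\,dy\;=\;2\sqrt{2}\,\log\left(1+\sqrt{2}\right).$$ Moreover, equality holds in the inequality if and only if either $f(x)=g(x)=\operatorname{sign}(x)$ for almost every $x\in\mathbb{R}$, or $f(x)=g(x)=-\operatorname{sign}(x)$ for almost every $x\in\mathbb{R}$. -/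

import Mathlib

open MeasureTheory

/-- The oscillatory Gaussian kernel `exp (-(x² + y²) / 2) * sin (x y)` on `ℝ × ℝ`. -/
noncomputable def oscKernel (x y : ℝ) : ℝ :=
  Real.exp (-(x ^ 2 + y ^ 2) / 2) * Real.sin (x * y)

/-- The bilinear form `∫∫ f(x) g(y) exp (-(x² + y²) / 2) sin (x y) dx dy`. -/
noncomputable def oscForm (f g : ℝ → ℝ) : ℝ :=
  ∫ y : ℝ, ∫ x : ℝ, f x * g y * oscKernel x y

/-- The double integral defining `oscForm f g` is absolutely convergent. -/
def OscIntegrable (f g : ℝ → ℝ) : Prop :=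
  Integrable (fun p : ℝ × ℝ => f p.1 * g p.2 * oscKernel p.1 p.2) (volume.prod volume)

/-! The kernel is odd in each variable, so folding both axes writes the form as four copies of
`sineForm`, one for each choice of `u` in {f, -f(-·)} and `v` in {g, -g(-·)}. It therefore suffices
to show `sineForm u v ≤ sineForm 1 1` for ±1-valued functions on the half-line (`sineForm_le`), with
equality only for (1, 1) and (-1, -1).

With a = (1 - u)/2 and c = (1 - v)/2, half the deficit is the integral of (a + c - 2ac) sin(xy),
where the weight is the indicator of a ≠ c. The difficulty is that sin(xy) changes sign. Replacing
(u, v) by (-u, -v) allows the assumption α + β ≤ Φ, where α, β, Φ are the Gaussian integrals of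
a·`ramp`, c·`ramp` and `ramp`.

The kernel is then bounded below by pieces that decouple. On the square (0, 13/8]² a rank-one
minorant `ramp x * ramp y` contributes Φ(α + β) - 2αβ ≥ Φ(α + β)/2. When exactly one variable
exceeds 13/8, the oscillation is charged separately to a and to c through `crossKernel`. When both
exceed it, the loss is at most twice a product of tail masses, controlled by Cauchy-Schwarz
(`sq_integral_tail_le`). Altogether half the deficit is at least ∫ a ρ + ∫ c ρ with ρ =
`chargeDensity` (`integral_chargeDensity_le`).

The decisive fact is the strict inequality ρ > 0 on the half-line (`chargeDensity_pos`), which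
yields both the bound and the equality cases. For large x it rests on the sine transform of the
half-Gaussian being at least 1/x; elsewhere it is numerical. The sharp constant comes from an
integral representation of the same transform. -/

/-! ### The half-line Gaussian measure and its sine transform -/

section HalfGaussian

open Set Filter Topology

/-- The measure `exp (-x² / 2) dx` on the positive half-line. -/
noncomputable def halfGaussian : Measure ℝ :=
  (volume.restrict (Ioi 0)).withDensity fun x => ENNReal.ofReal (Real.exp (-x ^ 2 / 2))

theorem integral_halfGaussian (h : ℝ → ℝ) :
    ∫ x, h x ∂halfGaussian = ∫ x in Ioi 0, Real.exp (-x ^ 2 / 2) * h x := by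
  rw [halfGaussian, integral_withDensity_eq_integral_toReal_smul (by fun_prop) (by simp)]
  refine integral_congr_ae (ae_of_all _ fun x => ?_)
  simp [ENNReal.toReal_ofReal (Real.exp_pos _).le]

theorem setIntegral_halfGaussian (h : ℝ → ℝ) {b : ℝ} (hb : 0 ≤ b) :
    ∫ x in Ioi b, h x ∂halfGaussian = ∫ x in Ioi b, Real.exp (-x ^ 2 / 2) * h x := by
  rw [← integral_indicator measurableSet_Ioi, integral_halfGaussian]
  have : (fun x => Real.exp (-x ^ 2 / 2) * (Ioi b).indicator h x) =
      (Ioi b).indicator (fun x => Real.exp (-x ^ 2 / 2) * h x) := by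
    ext x
    by_cases hx : x ∈ Ioi b <;> simp [hx]
  rw [this, setIntegral_indicator measurableSet_Ioi, Ioi_inter_Ioi, max_eq_right hb]

theorem integrable_halfGaussian_iff {h : ℝ → ℝ} :
    Integrable h halfGaussian ↔ IntegrableOn (fun x => Real.exp (-x ^ 2 / 2) * h x) (Ioi 0) := by
  rw [halfGaussian, integrable_withDensity_iff_integrable_smul' (by fun_prop) (by simp),
    IntegrableOn]
  refine integrable_congr (ae_of_all _ fun x => ?_)
  simp [ENNReal.toReal_ofReal (Real.exp_pos _).le]

theorem ae_halfGaussian_iff {p : ℝ → Prop} :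
    (∀ᵐ x ∂halfGaussian, p x) ↔ ∀ᵐ x ∂(volume : Measure ℝ), 0 < x → p x := by
  rw [halfGaussian, ae_withDensity_iff (by fun_prop), ae_restrict_iff' measurableSet_Ioi]
  simp [Real.exp_pos]

theorem halfGaussian_absolutelyContinuous : halfGaussian ≪ (volume : Measure ℝ) :=
  (withDensity_absolutelyContinuous _ _).trans Measure.restrict_le_self.absolutelyContinuous

instance : IsFiniteMeasure halfGaussian := by
  refine ⟨?_⟩
  have h : Integrable (fun _ : ℝ => (1 : ℝ)) halfGaussian := by
    rw [integrable_halfGaussian_iff]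
    have := (integrable_exp_neg_mul_sq (b := 1 / 2) (by norm_num)).integrableOn (s := Ioi 0)
    refine this.congr (ae_of_all _ fun x => ?_)
    simp only [mul_one]
    congr 1
    ring
  simpa using (integrable_const_iff.1 h).resolve_left one_ne_zero |>.measure_univ_lt_top

theorem ae_pos_halfGaussian : ∀ᵐ x ∂halfGaussian, 0 < x :=
  ae_halfGaussian_iff.2 (ae_of_all _ fun _ h => h)

theorem hasDerivAt_neg_exp_neg_mul_sq {k : ℝ} (hk : 0 < k) (x : ℝ) :
    HasDerivAt (fun x => -Real.exp (-(k * x ^ 2)) / (2 * k)) (x * Real.exp (-(k * x ^ 2))) x := by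
  have h := ((((hasDerivAt_pow 2 x).const_mul k).neg.exp).neg).div_const (2 * k)
  refine h.congr_deriv ?_
  field_simp
  simp
  ring

theorem tendsto_neg_exp_neg_mul_sq {k : ℝ} (hk : 0 < k) :
    Tendsto (fun x : ℝ => -Real.exp (-(k * x ^ 2)) / (2 * k)) atTop (𝓝 0) := by
  have h1 : Tendsto (fun x : ℝ => k * x ^ 2) atTop atTop :=
    (tendsto_pow_atTop two_ne_zero).const_mul_atTop hk
  have h2 := (Real.tendsto_exp_neg_atTop_nhds_zero.comp h1).neg.div_const (2 * k)
  simpa using h2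

theorem integrableOn_mul_exp_neg_mul_sq {k b : ℝ} (hk : 0 < k) (hb : 0 ≤ b) :
    IntegrableOn (fun x => x * Real.exp (-(k * x ^ 2))) (Ioi b) :=
  integrableOn_Ioi_deriv_of_nonneg' (fun x _ => hasDerivAt_neg_exp_neg_mul_sq hk x)
    (fun _ hx => mul_nonneg (hb.trans (le_of_lt hx)) (Real.exp_pos _).le)
    (tendsto_neg_exp_neg_mul_sq hk)

theorem integral_Ioi_mul_exp_neg_mul_sq {k b : ℝ} (hk : 0 < k) (hb : 0 ≤ b) :
    ∫ x in Ioi b, x * Real.exp (-(k * x ^ 2)) = Real.exp (-(k * b ^ 2)) / (2 * k) := by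
  rw [integral_Ioi_of_hasDerivAt_of_nonneg' (fun x _ => hasDerivAt_neg_exp_neg_mul_sq hk x)
    (fun _ hx => mul_nonneg (hb.trans (le_of_lt hx)) (Real.exp_pos _).le)
    (tendsto_neg_exp_neg_mul_sq hk)]
  ring

theorem integrable_id_halfGaussian : Integrable (fun x => x) halfGaussian := by
  rw [integrable_halfGaussian_iff]
  refine (integrableOn_mul_exp_neg_mul_sq (k := 1 / 2) (by norm_num) le_rfl).congr
    (ae_of_all _ fun x => ?_)
  simp only [mul_comm x]
  congr 2
  ring

theorem setIntegral_id_halfGaussian {b : ℝ} (hb : 0 ≤ b) :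
    ∫ x in Ioi b, x ∂halfGaussian = Real.exp (-b ^ 2 / 2) := by
  rw [setIntegral_halfGaussian _ hb]
  have h := integral_Ioi_mul_exp_neg_mul_sq (k := 1 / 2) (by norm_num) hb
  have e : ∀ x : ℝ, -(1 / 2 * x ^ 2) = -x ^ 2 / 2 := fun x => by ring
  simp only [e] at h
  simp only [mul_comm (Real.exp _)]
  rw [h]
  norm_num

theorem integrable_sin_halfGaussian (y : ℝ) :
    Integrable (fun x => Real.sin (x * y)) halfGaussian :=
  Integrable.of_bound (by fun_prop) 1 (ae_of_all _ fun x => by simpa using Real.abs_sin_le_one _)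

theorem integrable_mul_cos_halfGaussian (y : ℝ) :
    Integrable (fun x => x * Real.cos (x * y)) halfGaussian := by
  refine integrable_id_halfGaussian.mono (by fun_prop) (ae_of_all _ fun x => ?_)
  rw [norm_mul]
  exact mul_le_of_le_one_right (norm_nonneg _) (by simpa using Real.abs_cos_le_one _)

/-- The sine transform of the half-line Gaussian. -/
noncomputable def gaussSine (y : ℝ) : ℝ := ∫ x, Real.sin (x * y) ∂halfGaussian

/-- Integration by parts against the derivative of `exp (-x ^ 2 / 2)`. The left side is the
derivative of `gaussSine`, so this is the linear equation S' = 1 - yS. -/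
theorem integral_mul_cos_halfGaussian (y : ℝ) :
    ∫ x, x * Real.cos (x * y) ∂halfGaussian = 1 - y * gaussSine y := by
  have hd : ∀ x ∈ Ici (0 : ℝ), HasDerivAt (fun x => -(Real.exp (-x ^ 2 / 2) * Real.cos (x * y)))
      (Real.exp (-x ^ 2 / 2) * (x * Real.cos (x * y) + y * Real.sin (x * y))) x := by
    intro x _
    have h1 : HasDerivAt (fun x : ℝ => -x ^ 2 / 2) (-x) x := by
      have := ((hasDerivAt_pow 2 x).neg).div_const 2
      exact this.congr_deriv (by simp; ring)
    have h2 : HasDerivAt (fun x : ℝ => x * y) y x := by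
      simpa using (hasDerivAt_id x).mul_const y
    exact (h1.exp.mul h2.cos).neg.congr_deriv (by ring)
  have hi : Integrable (fun x => x * Real.cos (x * y) + y * Real.sin (x * y)) halfGaussian :=
    (integrable_mul_cos_halfGaussian y).add ((integrable_sin_halfGaussian y).const_mul y)
  have ht : Tendsto (fun x : ℝ => -(Real.exp (-x ^ 2 / 2) * Real.cos (x * y))) atTop (𝓝 0) := by
    refine squeeze_zero_norm (a := fun x : ℝ => Real.exp (-x ^ 2 / 2)) (fun x => ?_) ?_
    · rw [norm_neg, norm_mul, Real.norm_of_nonneg (Real.exp_pos _).le]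
      exact mul_le_of_le_one_right (Real.exp_pos _).le (by simpa using Real.abs_cos_le_one _)
    · have h := (tendsto_neg_exp_neg_mul_sq (k := 1 / 2) (by norm_num)).neg
      simp only [neg_zero] at h
      refine h.congr fun x => ?_
      rw [show -(1 / 2 * x ^ 2) = -x ^ 2 / 2 by ring]
      ring
  have h := integral_Ioi_of_hasDerivAt_of_tendsto' hd (integrable_halfGaussian_iff.1 hi) ht
  rw [← integral_halfGaussian, integral_add (integrable_mul_cos_halfGaussian y)
    ((integrable_sin_halfGaussian y).const_mul y), integral_const_mul] at h
  simp only [ne_eq, OfNat.ofNat_ne_zero, not_false_eq_true, zero_pow, neg_zero, zero_div,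
    Real.exp_zero, zero_mul, Real.cos_zero, mul_one, sub_neg_eq_add, zero_add] at h
  rw [gaussSine]
  linarith

theorem hasDerivAt_gaussSine (y : ℝ) : HasDerivAt gaussSine (1 - y * gaussSine y) y := by
  have h := hasDerivAt_integral_of_dominated_loc_of_deriv_le (μ := halfGaussian)
    (F := fun y x => Real.sin (x * y)) (F' := fun y x => x * Real.cos (x * y)) (x₀ := y)
    (s := univ) (bound := fun x => |x|) univ_mem (Eventually.of_forall fun z => by fun_prop)
    (integrable_sin_halfGaussian y) (by fun_prop)
    (ae_of_all _ fun x z _ => by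
      rw [norm_mul]
      exact mul_le_of_le_one_right (norm_nonneg _) (by simpa using Real.abs_cos_le_one _))
    integrable_id_halfGaussian.abs
    (ae_of_all _ fun x z _ => by
      have h2 : HasDerivAt (fun z : ℝ => x * z) x z := by
        simpa using (hasDerivAt_id z).const_mul x
      simpa [mul_comm] using h2.sin)
  rw [← integral_mul_cos_halfGaussian]
  exact h.2

/-- `exp (y ^ 2 / 2)` is the integrating factor of S' = 1 - yS, and S(0) = 0. -/
theorem exp_mul_gaussSine (y : ℝ) :
    Real.exp (y ^ 2 / 2) * gaussSine y = ∫ t in (0 : ℝ)..y, Real.exp (t ^ 2 / 2) := by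
  have hd : ∀ t ∈ uIcc 0 y, HasDerivAt (fun y => Real.exp (y ^ 2 / 2) * gaussSine y)
      (Real.exp (t ^ 2 / 2)) t := by
    intro t _
    have h1 : HasDerivAt (fun x : ℝ => x ^ 2 / 2) t t := by
      have := (hasDerivAt_pow 2 t).div_const 2
      exact this.congr_deriv (by simp)
    exact (h1.exp.mul (hasDerivAt_gaussSine t)).congr_deriv (by ring)
  rw [intervalIntegral.integral_eq_sub_of_hasDerivAt hd
    (Continuous.intervalIntegrable (by fun_prop) _ _)]
  simp [gaussSine]

end HalfGaussian

/-! ### Lower bound for the sine transform, and its total Gaussian integral -/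

section GaussSine

open Set Filter Topology

theorem exp_sq_half_div_le_integral :
    Real.exp ((13 / 8 : ℝ) ^ 2 / 2) / (13 / 8) ≤ ∫ t in (0 : ℝ)..(13 / 8), Real.exp (t ^ 2 / 2) := by
  have h1 : ∫ t in (0 : ℝ)..(13 / 8), (1 + t ^ 2 / 2 + (t ^ 2 / 2) ^ 2 / 2) ≤
      ∫ t in (0 : ℝ)..(13 / 8), Real.exp (t ^ 2 / 2) := by
    refine intervalIntegral.integral_mono_on (by norm_num)
      (Continuous.intervalIntegrable (by fun_prop) _ _)
      (Continuous.intervalIntegrable (by fun_prop) _ _) fun t _ => ?_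
    exact Real.quadratic_le_exp_of_nonneg (by positivity)
  have h2 : ∫ t in (0 : ℝ)..(13 / 8), (1 + t ^ 2 / 2 + (t ^ 2 / 2) ^ 2 / 2) =
      13 / 8 + (13 / 8) ^ 3 / 6 + (13 / 8) ^ 5 / 40 := by
    have hd : ∀ t ∈ uIcc (0 : ℝ) (13 / 8), HasDerivAt (fun t : ℝ => t + t ^ 3 / 6 + t ^ 5 / 40)
        (1 + t ^ 2 / 2 + (t ^ 2 / 2) ^ 2 / 2) t := by
      intro t _
      refine (((hasDerivAt_id t).add ((hasDerivAt_pow 3 t).div_const 6)).add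
        ((hasDerivAt_pow 5 t).div_const 40)).congr_deriv ?_
      norm_num
      ring
    rw [intervalIntegral.integral_eq_sub_of_hasDerivAt hd
      (Continuous.intervalIntegrable (by fun_prop) _ _)]
    norm_num
  -- The exponent is 169/128 = 1 + 41/128.
  have h3 : Real.exp ((13 / 8 : ℝ) ^ 2 / 2) ≤ 4 := by
    have e1 := Real.exp_one_lt_d9
    have e2 : Real.exp ((13 / 8 : ℝ) ^ 2 / 2) = Real.exp 1 * Real.exp (41 / 128) := by
      rw [← Real.exp_add]
      norm_num
    have e3 : Real.exp (41 / 128) * (1 - 41 / 128) ≤ 1 := by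
      have := Real.add_one_le_exp (-(41 / 128 : ℝ))
      calc _ ≤ Real.exp (41 / 128) * Real.exp (-(41 / 128)) := by gcongr; linarith
        _ = 1 := by rw [← Real.exp_add]; simp
    rw [e2]
    nlinarith [Real.exp_pos (41 / 128 : ℝ)]
  rw [h2] at h1
  refine le_trans ?_ h1
  rw [div_le_iff₀ (by norm_num)]
  refine h3.trans ?_
  norm_num

/-- The difference of the two sides has derivative `exp (y ^ 2 / 2) / y ^ 2`, which is positive, so
the numerical check at 13/8 propagates to all larger y. -/
theorem exp_sq_half_div_le {y : ℝ} (hy : 13 / 8 ≤ y) :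
    Real.exp (y ^ 2 / 2) / y ≤ ∫ t in (0 : ℝ)..y, Real.exp (t ^ 2 / 2) := by
  let G : ℝ → ℝ := fun y => (∫ t in (0 : ℝ)..y, Real.exp (t ^ 2 / 2)) - Real.exp (y ^ 2 / 2) / y
  have hd : ∀ x : ℝ, 0 < x → HasDerivAt G (Real.exp (x ^ 2 / 2) / x ^ 2) x := by
    intro x hx
    have h1 : HasDerivAt (fun x : ℝ => x ^ 2 / 2) x x :=
      ((hasDerivAt_pow 2 x).div_const 2).congr_deriv (by simp)
    have h2 : HasDerivAt (fun y => ∫ t in (0 : ℝ)..y, Real.exp (t ^ 2 / 2))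
        (Real.exp (x ^ 2 / 2)) x :=
      intervalIntegral.integral_hasDerivAt_right
        (Continuous.intervalIntegrable (by fun_prop) _ _)
        (Continuous.stronglyMeasurableAtFilter (by fun_prop) _ _) (by fun_prop)
    refine (h2.sub (h1.exp.div (hasDerivAt_id x) hx.ne')).congr_deriv ?_
    simp only [id]
    field_simp
    ring
  have hm : MonotoneOn G (Ici (13 / 8)) := by
    refine monotoneOn_of_deriv_nonneg (convex_Ici _) (fun x hx => ?_) (fun x hx => ?_)
      fun x hx => ?_
    · exact (hd x (lt_of_lt_of_le (by norm_num) hx)).continuousAt.continuousWithinAt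
    · rw [interior_Ici] at hx
      exact (hd x (lt_trans (by norm_num) hx)).differentiableAt.differentiableWithinAt
    · rw [interior_Ici] at hx
      rw [(hd x (lt_trans (by norm_num) hx)).deriv]
      positivity
  have h := hm self_mem_Ici (mem_Ici.2 hy) hy
  have h0 := exp_sq_half_div_le_integral
  simp only [G] at h
  linarith

theorem inv_le_gaussSine {y : ℝ} (hy : 13 / 8 ≤ y) : 1 / y ≤ gaussSine y := by
  have h := exp_sq_half_div_le hy
  rw [← exp_mul_gaussSine, div_eq_mul_one_div] at h
  exact le_of_mul_le_mul_left h (Real.exp_pos _)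

/-- Substituting t = ys makes the exponent quadratic in y for fixed s, so the outer Gaussian
integral becomes elementary. -/
theorem gaussSine_eq_integral (y : ℝ) :
    gaussSine y = ∫ s in (0 : ℝ)..1, y * Real.exp (-(y ^ 2 * (1 - s ^ 2) / 2)) := by
  have h := exp_mul_gaussSine y
  have h1 : y * ∫ s in (0 : ℝ)..1, Real.exp ((y * s) ^ 2 / 2) =
      ∫ t in (0 : ℝ)..y, Real.exp (t ^ 2 / 2) := by
    simpa using intervalIntegral.smul_integral_comp_mul_left (a := 0) (b := 1)
      (fun t => Real.exp (t ^ 2 / 2)) y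
  have h2 : gaussSine y = Real.exp (-(y ^ 2 / 2)) * (y * ∫ s in (0 : ℝ)..1,
      Real.exp ((y * s) ^ 2 / 2)) := by
    rw [h1, ← h, ← mul_assoc, ← Real.exp_add]
    simp
  rw [h2, ← intervalIntegral.integral_const_mul, ← intervalIntegral.integral_const_mul]
  refine intervalIntegral.integral_congr fun s _ => ?_
  rw [mul_left_comm, ← Real.exp_add]
  congr 2
  ring

theorem integral_inv_two_sub_sq :
    ∫ s in (0 : ℝ)..1, 1 / (2 - s ^ 2) = √2 / 2 * Real.log (1 + √2) := by
  have h2 : √2 ^ 2 = (2 : ℝ) := Real.sq_sqrt (by norm_num)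
  have h0 : (0 : ℝ) < √2 := by positivity
  have h1 : (1 : ℝ) < √2 := by nlinarith
  have hd : ∀ s ∈ uIcc (0 : ℝ) 1, HasDerivAt
      (fun s : ℝ => (Real.log (√2 + s) - Real.log (√2 - s)) / (2 * √2)) (1 / (2 - s ^ 2)) s := by
    intro s hs
    rw [uIcc_of_le zero_le_one] at hs
    have hp : 0 < √2 + s := by linarith [hs.1]
    have hm : 0 < √2 - s := by linarith [hs.2]
    have a1 := ((hasDerivAt_id s).const_add √2).log hp.ne'
    have a2 := ((hasDerivAt_id s).const_sub √2).log hm.ne'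
    refine ((a1.sub a2).div_const (2 * √2)).congr_deriv ?_
    have : 2 - s ^ 2 = (√2 + s) * (√2 - s) := by linear_combination -h2
    rw [this]
    simp only [id]
    field_simp
    ring
  have hc : ContinuousOn (fun s : ℝ => 1 / (2 - s ^ 2)) (uIcc 0 1) := by
    rw [uIcc_of_le zero_le_one]
    refine ContinuousOn.div (by fun_prop) (by fun_prop) fun s hs => ?_
    nlinarith [hs.1, hs.2]
  rw [intervalIntegral.integral_eq_sub_of_hasDerivAt hd hc.intervalIntegrable]
  have h3 : Real.log (√2 - 1) = -Real.log (1 + √2) := by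
    rw [← Real.log_inv]
    congr 1
    exact eq_inv_of_mul_eq_one_left (by linear_combination h2)
  rw [h3, add_comm √2 1]
  simp only [add_zero, sub_zero, sub_self, zero_div, sub_neg_eq_add]
  rw [div_eq_iff (by positivity)]
  linear_combination (-Real.log (1 + √2)) * h2

/-- After Fubini the y-integral of y exp(-(2 - s²)y²/2) is 1/(2 - s²). -/
theorem integral_gaussSine :
    ∫ y, gaussSine y ∂halfGaussian = √2 / 2 * Real.log (1 + √2) := by
  rw [← integral_inv_two_sub_sq]
  simp_rw [gaussSine_eq_integral]
  rw [← intervalIntegral_integral_swap]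
  · refine intervalIntegral.integral_congr fun s hs => ?_
    rw [uIcc_of_le zero_le_one] at hs
    have hk : 0 < (2 - s ^ 2) / 2 := by nlinarith [hs.1, hs.2]
    have h := integral_Ioi_mul_exp_neg_mul_sq hk le_rfl
    rw [integral_halfGaussian]
    calc _ = ∫ x in Ioi (0 : ℝ), x * Real.exp (-((2 - s ^ 2) / 2 * x ^ 2)) := by
          refine integral_congr_ae (ae_of_all _ fun x => ?_)
          simp only
          rw [mul_left_comm, ← Real.exp_add]
          congr 2
          ring
      _ = _ := by
          rw [h]
          simp [mul_div_cancel₀]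
  · have : IsFiniteMeasure (volume.restrict (uIoc (0 : ℝ) 1)) := by
      rw [uIoc_of_le zero_le_one]
      infer_instance
    -- For s in (0, 1] the exponential factor is at most 1, so y itself dominates the integrand.
    have hi : Integrable (fun p : ℝ × ℝ => p.2)
        ((volume.restrict (uIoc 0 1)).prod halfGaussian) :=
      integrable_id_halfGaussian.comp_snd _
    refine hi.mono (by fun_prop) ?_
    have hs : ∀ᵐ p ∂((volume.restrict (uIoc (0 : ℝ) 1)).prod halfGaussian), p.1 ∈ uIoc (0 : ℝ) 1 :=
      Measure.quasiMeasurePreserving_fst.ae (ae_restrict_mem measurableSet_uIoc)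
    filter_upwards [hs] with p hp
    rw [uIoc_of_le zero_le_one] at hp
    simp only [Function.uncurry, norm_mul]
    refine mul_le_of_le_one_right (norm_nonneg _) ?_
    rw [Real.norm_of_nonneg (Real.exp_pos _).le, Real.exp_le_one_iff]
    have : 0 ≤ 1 - p.1 ^ 2 := by nlinarith [hp.1, hp.2]
    have : 0 ≤ p.2 ^ 2 * (1 - p.1 ^ 2) / 2 := by positivity
    linarith

end GaussSine

/-! ### The rank-one minorant and numerical estimates -/

section Profile

open Set Filter Topology

theorem cubic_le_exp_neg {u : ℝ} (hu : 0 ≤ u) : 1 - u + u ^ 2 / 2 - u ^ 3 / 6 ≤ Real.exp (-u) := by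
  have hq : ∀ v : ℝ, 0 ≤ v → Real.exp (-v) ≤ 1 - v + v ^ 2 / 2 := by
    intro v hv
    have h1 := Real.quadratic_le_exp_of_nonneg hv
    have h2 : Real.exp v * Real.exp (-v) = 1 := by rw [← Real.exp_add]; simp
    have h3 := Real.exp_pos (-v)
    have h4 : (1 + v + v ^ 2 / 2) * Real.exp (-v) ≤ 1 := by
      exact (mul_le_mul_of_nonneg_right h1 h3.le).trans_eq h2
    have h5 : 1 ≤ (1 + v + v ^ 2 / 2) * (1 - v + v ^ 2 / 2) := by
      nlinarith [sq_nonneg (v ^ 2)]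
    have h6 : 0 < 1 + v + v ^ 2 / 2 := by positivity
    exact le_of_mul_le_mul_left (h4.trans h5) h6
  let F : ℝ → ℝ := fun u => Real.exp (-u) - (1 - u + u ^ 2 / 2 - u ^ 3 / 6)
  have hd : ∀ x, HasDerivAt F (1 - x + x ^ 2 / 2 - Real.exp (-x)) x := by
    intro x
    have h := (hasDerivAt_neg x).exp.sub ((((hasDerivAt_const x (1 : ℝ)).sub (hasDerivAt_id x)).add
      ((hasDerivAt_pow 2 x).div_const 2)).sub ((hasDerivAt_pow 3 x).div_const 6))
    refine h.congr_deriv ?_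
    norm_num
    ring
  have hm : MonotoneOn F (Ici 0) := by
    refine monotoneOn_of_deriv_nonneg (convex_Ici _)
      (fun x _ => (hd x).continuousAt.continuousWithinAt)
      (fun x _ => (hd x).differentiableAt.differentiableWithinAt) fun x hx => ?_
    rw [interior_Ici] at hx
    rw [(hd x).deriv]
    linarith [hq x (le_of_lt hx)]
  have h := hm self_mem_Ici (mem_Ici.2 hu) hu
  simp only [F] at h
  norm_num at h
  linarith

theorem poly_le_exp_neg_sq_half (x : ℝ) :
    1 - x ^ 2 / 2 + x ^ 4 / 8 - x ^ 6 / 48 ≤ Real.exp (-x ^ 2 / 2) := by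
  have h := cubic_le_exp_neg (u := x ^ 2 / 2) (by positivity)
  rw [show -(x ^ 2 / 2) = -x ^ 2 / 2 by ring] at h
  refine le_trans (le_of_eq ?_) h
  ring

/-- A truncated ramp whose tensor square minorises `sin (x y)` on `(0, 13/8]²`. -/
noncomputable def ramp : ℝ → ℝ :=
  (Ioc 0 (13 / 8)).indicator fun x => 17 / 25 * min (x / (7 / 10)) 1

theorem ramp_of_le {x : ℝ} (h0 : 0 < x) (h1 : x ≤ 13 / 8) :
    ramp x = 17 / 25 * min (x / (7 / 10)) 1 :=
  indicator_of_mem (s := Ioc (0 : ℝ) (13 / 8)) ⟨h0, h1⟩ _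

theorem ramp_of_lt {x : ℝ} (h : 13 / 8 < x) : ramp x = 0 :=
  indicator_of_notMem (fun hx => absurd hx.2 (not_le.2 h)) _

theorem measurable_ramp : Measurable ramp :=
  Measurable.indicator (by fun_prop) measurableSet_Ioc

theorem ramp_nonneg (x : ℝ) : 0 ≤ ramp x := by
  refine indicator_nonneg (fun y hy => ?_) x
  have : 0 ≤ min (y / (7 / 10)) 1 := le_min (div_nonneg hy.1.le (by norm_num)) zero_le_one
  positivity

theorem ramp_le_one (x : ℝ) : ramp x ≤ 1 := by
  refine indicator_le' (fun y _ => ?_) (fun _ _ => zero_le_one) x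
  have : min (y / (7 / 10)) 1 ≤ 1 := min_le_right _ _
  linarith

theorem integrable_ramp : Integrable ramp halfGaussian :=
  Integrable.of_bound measurable_ramp.aestronglyMeasurable 1 (ae_of_all _ fun x => by
    rw [Real.norm_of_nonneg (ramp_nonneg x)]
    exact ramp_le_one x)

/-- Here 49/100 = (7/10)² and 169/64 = (13/8)². Since π - 169/64 > 49/100, sin on [49/100, 169/64]
stays above sin(49/100), which exceeds (17/25)². -/
theorem mul_min_le_sin {u : ℝ} (h0 : 0 ≤ u) (h1 : u ≤ 169 / 64) :
    (17 / 25) ^ 2 * min (u / (49 / 100)) 1 ≤ Real.sin u := by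
  have key : ∀ v : ℝ, 0 ≤ v → v ≤ 1 / 2 → v * (23 / 24) ≤ Real.sin v := by
    intro v hv hv'
    have : v - v ^ 3 / 6 ≤ Real.sin v := Real.sin_ge_sub_cube hv
    nlinarith [mul_nonneg hv (mul_nonneg hv (sub_nonneg.2 hv')), mul_nonneg hv (sub_nonneg.2 hv')]
  have hpi := Real.pi_gt_d4
  have hpi' := Real.pi_lt_d4
  rcases le_total u (49 / 100) with h | h
  · have := key u h0 (by linarith)
    have : min (u / (49 / 100)) 1 ≤ u / (49 / 100) := min_le_left _ _
    linarith
  · have hmin : min (u / (49 / 100)) 1 ≤ 1 := min_le_right _ _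
    have h49 := key (49 / 100) (by norm_num) (by norm_num)
    refine le_trans ?_ (le_trans h49 ?_)
    · linarith
    · rcases le_total u (Real.pi / 2) with h2 | h2
      · exact Real.sin_le_sin_of_le_of_le_pi_div_two (by linarith) h2 h
      · rw [← Real.sin_pi_sub u]
        exact Real.sin_le_sin_of_le_of_le_pi_div_two (by linarith) (by linarith) (by linarith)

theorem ramp_mul_ramp_le_sin {x y : ℝ} (hx : 0 < x) (hx' : x ≤ 13 / 8) (hy : 0 < y)
    (hy' : y ≤ 13 / 8) : ramp x * ramp y ≤ Real.sin (x * y) := by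
  refine le_trans ?_ (mul_min_le_sin (mul_pos hx hy).le (by nlinarith))
  rw [ramp_of_le hx hx', ramp_of_le hy hy']
  have e : x * y / (49 / 100) = x / (7 / 10) * (y / (7 / 10)) := by ring
  rw [e]
  have hx0 : 0 ≤ x / (7 / 10) := by positivity
  have hy0 : 0 ≤ y / (7 / 10) := by positivity
  generalize x / (7 / 10) = p at *
  generalize y / (7 / 10) = q at *
  -- Truncating each factor costs at least as much as truncating the product; this is what allows a
  -- product minorant.
  have : min p 1 * min q 1 ≤ min (p * q) 1 :=
    le_min (mul_le_mul (min_le_left _ _) (min_le_left _ _) (le_min hy0 zero_le_one) hx0)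
      (mul_le_one₀ (min_le_right _ _) (le_min hy0 zero_le_one) (min_le_right _ _))
  linarith

theorem le_integral_ramp : 13 / 25 ≤ ∫ x, ramp x ∂halfGaussian := by
  rw [integral_halfGaussian]
  have e1 : ∫ x in Ioi 0, Real.exp (-x ^ 2 / 2) * ramp x =
      ∫ x in (0 : ℝ)..(13 / 8), Real.exp (-x ^ 2 / 2) * (17 / 25 * min (x / (7 / 10)) 1) := by
    rw [intervalIntegral.integral_of_le (by norm_num)]
    have : (fun x => Real.exp (-x ^ 2 / 2) * ramp x) = (Ioc 0 (13 / 8)).indicator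
        (fun x => Real.exp (-x ^ 2 / 2) * (17 / 25 * min (x / (7 / 10)) 1)) := by
      ext x
      by_cases hx : x ∈ Ioc (0 : ℝ) (13 / 8) <;> simp [hx, ramp]
    rw [this, setIntegral_indicator measurableSet_Ioc]
    congr 2
    exact inter_eq_right.2 fun x hx => hx.1
  rw [e1, ← intervalIntegral.integral_add_adjacent_intervals (b := 7 / 10)
    (Continuous.intervalIntegrable (by fun_prop) _ _)
    (Continuous.intervalIntegrable (by fun_prop) _ _)]
  have h1 : ∫ x in (0 : ℝ)..(7 / 10), 34 / 35 * ((1 - x ^ 2 / 2 + x ^ 4 / 8 - x ^ 6 / 48) * x) ≤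
      ∫ x in (0 : ℝ)..(7 / 10), Real.exp (-x ^ 2 / 2) * (17 / 25 * min (x / (7 / 10)) 1) := by
    refine intervalIntegral.integral_mono_on (by norm_num)
      (Continuous.intervalIntegrable (by fun_prop) _ _)
      (Continuous.intervalIntegrable (by fun_prop) _ _) fun x hx => ?_
    rw [min_eq_left (by rw [div_le_one (by norm_num)]; exact hx.2)]
    have := mul_le_mul_of_nonneg_right (poly_le_exp_neg_sq_half x) hx.1
    linarith
  have h2 : ∫ x in (7 / 10 : ℝ)..(13 / 8), 17 / 25 * (1 - x ^ 2 / 2 + x ^ 4 / 8 - x ^ 6 / 48) ≤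
      ∫ x in (7 / 10 : ℝ)..(13 / 8), Real.exp (-x ^ 2 / 2) * (17 / 25 * min (x / (7 / 10)) 1) := by
    refine intervalIntegral.integral_mono_on (by norm_num)
      (Continuous.intervalIntegrable (by fun_prop) _ _)
      (Continuous.intervalIntegrable (by fun_prop) _ _) fun x hx => ?_
    rw [min_eq_right (by rw [one_le_div (by norm_num)]; exact hx.1)]
    linarith [poly_le_exp_neg_sq_half x]
  have d1 : ∀ x ∈ uIcc (0 : ℝ) (7 / 10), HasDerivAt
      (fun x : ℝ => 34 / 35 * (x ^ 2 / 2 - x ^ 4 / 8 + x ^ 6 / 48 - x ^ 8 / 384))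
      (34 / 35 * ((1 - x ^ 2 / 2 + x ^ 4 / 8 - x ^ 6 / 48) * x)) x := by
    intro x _
    refine ((((((hasDerivAt_pow 2 x).div_const 2).sub ((hasDerivAt_pow 4 x).div_const 8)).add
      ((hasDerivAt_pow 6 x).div_const 48)).sub
      ((hasDerivAt_pow 8 x).div_const 384)).const_mul (34 / 35)).congr_deriv ?_
    norm_num
    ring
  have d2 : ∀ x ∈ uIcc (7 / 10 : ℝ) (13 / 8), HasDerivAt
      (fun x : ℝ => 17 / 25 * (x - x ^ 3 / 6 + x ^ 5 / 40 - x ^ 7 / 336))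
      (17 / 25 * (1 - x ^ 2 / 2 + x ^ 4 / 8 - x ^ 6 / 48)) x := by
    intro x _
    refine (((((hasDerivAt_id x).sub ((hasDerivAt_pow 3 x).div_const 6)).add
      ((hasDerivAt_pow 5 x).div_const 40)).sub
      ((hasDerivAt_pow 7 x).div_const 336)).const_mul (17 / 25)).congr_deriv ?_
    norm_num
    ring
  rw [intervalIntegral.integral_eq_sub_of_hasDerivAt d1
    (Continuous.intervalIntegrable (by fun_prop) _ _)] at h1
  rw [intervalIntegral.integral_eq_sub_of_hasDerivAt d2
    (Continuous.intervalIntegrable (by fun_prop) _ _)] at h2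
  norm_num at h1 h2 ⊢
  linarith

theorem exp_tail_lt : Real.exp (-(13 / 8 : ℝ) ^ 2 / 2) < 27 / 100 := by
  have e1 := Real.exp_one_gt_d9
  -- (13/8)²/2 = 1 + 41/128.
  have e2 : Real.exp (-(13 / 8 : ℝ) ^ 2 / 2) * (Real.exp 1 * Real.exp (41 / 128)) = 1 := by
    rw [← Real.exp_add, ← Real.exp_add]
    norm_num
  have e3 := Real.quadratic_le_exp_of_nonneg (x := 41 / 128) (by norm_num)
  have h0 := Real.exp_pos (-(13 / 8 : ℝ) ^ 2 / 2)
  have e4 : (2.718 : ℝ) * (1 + 41 / 128 + (41 / 128) ^ 2 / 2) ≤ Real.exp 1 * Real.exp (41 / 128) := by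
    gcongr
    linarith
  nlinarith

theorem exp_corner_lt : Real.exp (-(25 / 14 : ℝ) ^ 2 / 2) < 1 / 4 := by
  have e1 := Real.exp_one_gt_d9
  have e2 : Real.exp (-(25 / 14 : ℝ) ^ 2 / 2) * (Real.exp 1 * Real.exp (233 / 392)) = 1 := by
    rw [← Real.exp_add, ← Real.exp_add]
    norm_num
  have e3 := Real.quadratic_le_exp_of_nonneg (x := 233 / 392) (by norm_num)
  have h0 := Real.exp_pos (-(25 / 14 : ℝ) ^ 2 / 2)
  have e4 : (2.718 : ℝ) * (1 + 233 / 392 + (233 / 392) ^ 2 / 2) ≤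
      Real.exp 1 * Real.exp (233 / 392) := by
    gcongr
    linarith
  nlinarith

theorem lt_cos_five_fourths : 29 / 100 < Real.cos (5 / 4) := by
  -- The quadratic bound applied directly at 5/4 gives only 7/32, below the 27/100 needed to beat
  -- the tail; halving the angle first is sharp enough.
  have h1 : Real.cos (5 / 4) = 2 * Real.cos (5 / 8) ^ 2 - 1 := by
    rw [← Real.cos_two_mul]
    norm_num
  have h2 := Real.one_sub_sq_div_two_le_cos (x := 5 / 8)
  rw [h1]
  nlinarith

end Profile

/-! ### Charging the oscillating region, and positivity of the charge density -/

section CrossKernel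

open Set Filter Topology

/-- The part of `sin (x y)` outside the square `(0, 13/8]²` and the region `x y ≤ 5/4`, replaced
by its negative modulus for `x ≤ 13/8`. -/
noncomputable def crossKernel (x y : ℝ) : ℝ :=
  if 5 / 4 < x * y then
    if x ≤ 13 / 8 then if 13 / 8 < y then -|Real.sin (x * y)| else 0 else Real.sin (x * y)
  else 0

theorem measurable_crossKernel : Measurable fun p : ℝ × ℝ => crossKernel p.1 p.2 := by
  unfold crossKernel
  refine Measurable.ite (measurableSet_lt (by fun_prop) (by fun_prop)) (Measurable.ite
    (measurableSet_le (by fun_prop) (by fun_prop)) (Measurable.ite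
    (measurableSet_lt (by fun_prop) (by fun_prop)) ?_ measurable_const) (by fun_prop))
    measurable_const
  exact (continuous_abs.measurable.comp (by fun_prop)).neg

theorem abs_crossKernel_le_one (x y : ℝ) : |crossKernel x y| ≤ 1 := by
  unfold crossKernel
  split_ifs <;> simp [Real.abs_sin_le_one]

theorem integrable_crossKernel (x : ℝ) : Integrable (crossKernel x) halfGaussian :=
  Integrable.of_bound (measurable_crossKernel.comp measurable_prodMk_left).aestronglyMeasurable 1
    (ae_of_all _ fun y => by simpa using abs_crossKernel_le_one x y)

/-- Pointwise lower bound for `sin (x y)` weighted by the disagreement of two indicators. -/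
theorem disagreement_mul_sin_ge {x y a c : ℝ} (hx : 0 < x) (hy : 0 < y) (ha : a = 0 ∨ a = 1)
    (hc : c = 0 ∨ c = 1) :
    (a + c - 2 * (a * c)) * (ramp x * ramp y) + a * crossKernel x y + c * crossKernel y x -
      2 * ((Ioi (13 / 8)).indicator 1 x * a * ((Ioi (13 / 8)).indicator 1 y * c)) ≤
    (a + c - 2 * (a * c)) * Real.sin (x * y) := by
  have hs := abs_le.1 (Real.abs_sin_le_one (x * y))
  have hn := neg_abs_le (Real.sin (x * y))
  have hp := le_abs_self (Real.sin (x * y))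
  have h0 := abs_nonneg (Real.sin (x * y))
  have hpi := Real.pi_gt_three
  have hsmall : x * y ≤ 5 / 4 → 0 ≤ Real.sin (x * y) := fun h =>
    Real.sin_nonneg_of_nonneg_of_le_pi (mul_pos hx hy).le (by linarith)
  unfold crossKernel
  rw [mul_comm y x]
  rcases le_or_gt x (13 / 8) with hx' | hx' <;> rcases le_or_gt y (13 / 8) with hy' | hy'
  · have := ramp_mul_ramp_le_sin hx hx' hy hy'
    rcases ha with rfl | rfl <;> rcases hc with rfl | rfl <;>
      simp [hx', hy', not_lt.2 hx', not_lt.2 hy'] <;> linarith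
  · rw [ramp_of_lt hy']
    by_cases hxy : 5 / 4 < x * y
    · rcases ha with rfl | rfl <;> rcases hc with rfl | rfl <;>
        simp [hx', hy', hxy, not_lt.2 hx', not_le.2 hy'] <;> linarith
    · have := hsmall (not_lt.1 hxy)
      rcases ha with rfl | rfl <;> rcases hc with rfl | rfl <;>
        norm_num [hxy, not_lt.2 hx', this]
  · rw [ramp_of_lt hx']
    by_cases hxy : 5 / 4 < x * y
    · rcases ha with rfl | rfl <;> rcases hc with rfl | rfl <;>
        simp [hx', hy', hxy, not_lt.2 hy', not_le.2 hx'] <;> linarith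
    · have := hsmall (not_lt.1 hxy)
      rcases ha with rfl | rfl <;> rcases hc with rfl | rfl <;>
        norm_num [hxy, not_lt.2 hy', this]
  -- Both variables are in the tail. The only nontrivial case is a = c = 1, where the weight
  -- vanishes while both charges count sin(xy); subtracting 2 covers this because sin ≤ 1.
  · have hxy : 5 / 4 < x * y := by nlinarith
    rw [ramp_of_lt hx']
    rcases ha with rfl | rfl <;> rcases hc with rfl | rfl <;>
      simp [hx', hy', hxy, not_le.2 hy', not_le.2 hx']
    linarith

theorem le_integral_crossKernel {x b k : ℝ} (hb : 0 ≤ b)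
    (h : ∀ y, 0 < y → -(Ioi b).indicator (fun y => k * y) y ≤ crossKernel x y) :
    -(k * Real.exp (-b ^ 2 / 2)) ≤ ∫ y, crossKernel x y ∂halfGaussian := by
  have hi : Integrable ((Ioi b).indicator fun y => k * y) halfGaussian :=
    (integrable_id_halfGaussian.const_mul k).indicator measurableSet_Ioi
  have e : -(k * Real.exp (-b ^ 2 / 2)) =
      ∫ y, -(Ioi b).indicator (fun y => k * y) y ∂halfGaussian := by
    rw [integral_neg, integral_indicator measurableSet_Ioi, integral_const_mul,
      setIntegral_id_halfGaussian hb]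
  rw [e]
  refine integral_mono_ae hi.neg (integrable_crossKernel x) ?_
  filter_upwards [ae_pos_halfGaussian] with y hy
  exact h y hy

/-- Where the kernel is nonzero, y > (5/4)/(7/10) = 25/14, and there |sin(xy)| ≤ xy. The bound is
linear in x, as is the ramp on this range. -/
theorem le_integral_crossKernel_of_le {x : ℝ} (hx : 0 < x) (hx' : x ≤ 7 / 10) :
    -(x * Real.exp (-(25 / 14) ^ 2 / 2)) ≤ ∫ y, crossKernel x y ∂halfGaussian := by
  refine le_integral_crossKernel (by norm_num) fun y hy => ?_
  unfold crossKernel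
  by_cases hxy : 5 / 4 < x * y
  · have hy' : 25 / 14 < y := by nlinarith
    have hx1 : x ≤ 13 / 8 := by linarith
    have hy1 : 13 / 8 < y := by linarith
    have := Real.abs_sin_le_abs (x := x * y)
    rw [abs_of_pos (mul_pos hx hy)] at this
    simp [hxy, hy', hx1, hy1, this]
  · have : 0 ≤ (Ioi (25 / 14)).indicator (fun y => x * y) y :=
      indicator_apply_nonneg fun _ => (mul_pos hx hy).le
    simp [hxy, this]

/-- On the support y > 13/8, so |sin| ≤ 1 ≤ (8/13)y, and y integrates exactly against the Gaussian.
-/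
theorem le_integral_crossKernel_of_le' {x : ℝ} (hx' : x ≤ 13 / 8) :
    -(8 / 13 * Real.exp (-(13 / 8) ^ 2 / 2)) ≤ ∫ y, crossKernel x y ∂halfGaussian := by
  refine le_integral_crossKernel (by norm_num) fun y hy => ?_
  unfold crossKernel
  by_cases hy1 : 13 / 8 < y
  · have := Real.abs_sin_le_one (x * y)
    by_cases hxy : 5 / 4 < x * y
    · simp [hxy, hx', hy1]
      linarith
    · simp [hxy, hy1]
      linarith
  · simp [hy1, hx']

/-- The sine is nonnegative on this range, so the Gaussian weight can be replaced by 1. -/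
theorem setIntegral_Iic_sin_le {x c : ℝ} (hx : 0 < x) (hc : 0 ≤ c) (hc' : c ≤ Real.pi) :
    ∫ y in Iic (c / x), Real.sin (y * x) ∂halfGaussian ≤ (1 - Real.cos c) / x := by
  have hcx : 0 ≤ c / x := by positivity
  rw [← integral_indicator measurableSet_Iic, integral_halfGaussian]
  have e : ∫ y in Ioi (0 : ℝ), Real.exp (-y ^ 2 / 2) *
      (Iic (c / x)).indicator (fun y => Real.sin (y * x)) y =
      ∫ y in (0 : ℝ)..(c / x), Real.exp (-y ^ 2 / 2) * Real.sin (y * x) := by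
    rw [intervalIntegral.integral_of_le hcx, ← Ioi_inter_Iic,
      ← setIntegral_indicator measurableSet_Iic]
    congr 1
    ext y
    by_cases hy : y ∈ Iic (c / x) <;> simp [hy]
  rw [e]
  have h1 : ∫ y in (0 : ℝ)..(c / x), Real.exp (-y ^ 2 / 2) * Real.sin (y * x) ≤
      ∫ y in (0 : ℝ)..(c / x), Real.sin (y * x) := by
    refine intervalIntegral.integral_mono_on hcx
      (Continuous.intervalIntegrable (by fun_prop) _ _)
      (Continuous.intervalIntegrable (by fun_prop) _ _) fun y hy => ?_
    refine mul_le_of_le_one_left (Real.sin_nonneg_of_nonneg_of_le_pi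
      (mul_nonneg hy.1 hx.le) (((le_div_iff₀ hx).1 hy.2).trans hc')) ?_
    rw [Real.exp_le_one_iff]
    have := sq_nonneg y
    linarith
  refine h1.trans (le_of_eq ?_)
  rw [intervalIntegral.integral_comp_mul_right (fun y => Real.sin y) hx.ne', integral_sin]
  simp only [zero_mul, Real.cos_zero, smul_eq_mul]
  rw [div_mul_cancel₀ _ hx.ne']
  ring

/-- For such x the kernel is the full sine with y ≤ 5/(4x) removed. The full transform is at least
1/x and the removed part at most (1 - cos(5/4))/x. -/
theorem le_integral_crossKernel_of_lt {x : ℝ} (hx : 13 / 8 < x) :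
    Real.cos (5 / 4) / x ≤ ∫ y, crossKernel x y ∂halfGaussian := by
  have hx0 : 0 < x := by linarith
  have e : crossKernel x = (Iic (5 / 4 / x))ᶜ.indicator fun y => Real.sin (y * x) := by
    ext y
    by_cases hy : 5 / 4 < x * y
    · have : 5 / 4 / x < y := by rwa [div_lt_iff₀ hx0, mul_comm]
      simp [crossKernel, hy, not_le.2 hx, this, mul_comm]
    · have : ¬ 5 / 4 / x < y := by rwa [div_lt_iff₀ hx0, mul_comm]
      simp [crossKernel, hy, this]
  have h1 := inv_le_gaussSine hx.le
  have h2 := setIntegral_Iic_sin_le (c := 5 / 4) hx0 (by norm_num)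
    (by linarith [Real.pi_gt_three])
  have h3 := integral_add_compl (measurableSet_Iic (a := 5 / 4 / x))
    (integrable_sin_halfGaussian x)
  rw [e, integral_indicator measurableSet_Iic.compl]
  rw [gaussSine] at h1
  have : Real.cos (5 / 4) / x = 1 / x - (1 - Real.cos (5 / 4)) / x := by ring
  linarith

/-- The density against which the disagreement sets are charged. -/
noncomputable def chargeDensity (x : ℝ) : ℝ :=
  (∫ y, ramp y ∂halfGaussian) / 2 * ramp x + ∫ y, crossKernel x y ∂halfGaussian -
    (Ioi (13 / 8)).indicator (fun x => Real.exp (-(13 / 8) ^ 2 / 2) / x) x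

/-- The cutoffs are tuned to three ranges. Up to 7/10 the ramp term is at least 0.252x against a
loss below x/4; up to 13/8 it is at least 0.176 against a loss below 0.167; beyond 13/8, cos(5/4) >
0.29 beats the tail constant, which is below 0.27. -/
theorem chargeDensity_pos {x : ℝ} (hx : 0 < x) : 0 < chargeDensity x := by
  have hR := le_integral_ramp
  unfold chargeDensity
  rcases le_or_gt x (13 / 8) with h | h
  · have hn : x ∉ Ioi (13 / 8 : ℝ) := not_lt.2 h
    rw [indicator_of_notMem hn, ramp_of_le hx h]
    rcases le_total x (7 / 10) with h' | h'
    · have := le_integral_crossKernel_of_le hx h'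
      have h2 := exp_corner_lt
      rw [min_eq_left (by rw [div_le_one (by norm_num)]; exact h')]
      nlinarith [mul_le_mul_of_nonneg_right hR hx.le, mul_lt_mul_of_pos_right h2 hx]
    · have := le_integral_crossKernel_of_le' h
      have h2 := exp_tail_lt
      rw [min_eq_right (by rw [one_le_div (by norm_num)]; exact h')]
      linarith
  · have hn : x ∈ Ioi (13 / 8 : ℝ) := h
    rw [indicator_of_mem hn, ramp_of_lt h]
    have h1 := le_integral_crossKernel_of_lt h
    have h2 : Real.exp (-(13 / 8) ^ 2 / 2) / x < Real.cos (5 / 4) / x := by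
      gcongr
      linarith [exp_tail_lt, lt_cos_five_fourths]
    linarith

end CrossKernel

/-! ### The extremal problem on the half-line -/

section HalfLine

open Set Filter Topology

/-- Cauchy-Schwarz for b = √(bx)·√(b/x) on the tail, with b ≤ 1 and τ = ∫ x over the tail. It turns
a squared tail mass into a quantity linear in b. -/
theorem sq_integral_tail_le {b : ℝ → ℝ} (hb : AEStronglyMeasurable b halfGaussian)
    (hb' : ∀ x, |b x| ≤ 1) (hb0 : ∀ x, 0 ≤ b x) :
    (∫ x, (Ioi (13 / 8)).indicator 1 x * b x ∂halfGaussian) ^ 2 ≤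
      ∫ x, b x * (Ioi (13 / 8)).indicator (fun x => Real.exp (-(13 / 8) ^ 2 / 2) / x) x
        ∂halfGaussian := by
  set τ := Real.exp (-(13 / 8 : ℝ) ^ 2 / 2) with hτ
  set p := ∫ x, (Ioi (13 / 8)).indicator 1 x * b x ∂halfGaussian with hp
  have hτ0 : 0 < τ := Real.exp_pos _
  have hi1 : Integrable (fun x => (Ioi (13 / 8 : ℝ)).indicator 1 x * b x) halfGaussian := by
    refine Integrable.of_bound (((measurable_one.indicator
      measurableSet_Ioi).aestronglyMeasurable).mul hb) 1 (ae_of_all _ fun x => ?_)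
    by_cases hx : x ∈ Ioi (13 / 8 : ℝ) <;> simp [hx, hb']
  have hi2 : Integrable (fun x => (Ioi (13 / 8 : ℝ)).indicator (fun x => x) x) halfGaussian :=
    integrable_id_halfGaussian.indicator measurableSet_Ioi
  have hi3 : Integrable (fun x => b x * (Ioi (13 / 8 : ℝ)).indicator (fun x => τ / x) x)
      halfGaussian := by
    refine Integrable.of_bound (hb.mul (Measurable.indicator (by fun_prop)
      measurableSet_Ioi).aestronglyMeasurable) τ (ae_of_all _ fun x => ?_)
    by_cases hx : x ∈ Ioi (13 / 8 : ℝ)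
    · have hx1 : (1 : ℝ) ≤ x := le_trans (by norm_num) (le_of_lt hx)
      rw [indicator_of_mem hx, norm_mul, Real.norm_of_nonneg (by positivity : 0 ≤ τ / x)]
      calc _ ≤ 1 * τ := mul_le_mul (hb' x) (div_le_self hτ0.le hx1) (by positivity) zero_le_one
        _ = τ := one_mul _
    · simp [hx, hτ0.le]
  -- Cauchy-Schwarz in pointwise form: 2pb - p²x/τ ≤ bτ/x on the tail. The left side integrates to
  -- 2p² - p² = p².
  have h : ∫ x, (2 * p * ((Ioi (13 / 8 : ℝ)).indicator 1 x * b x) -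
      p ^ 2 / τ * (Ioi (13 / 8 : ℝ)).indicator (fun x => x) x) ∂halfGaussian ≤
      ∫ x, b x * (Ioi (13 / 8)).indicator (fun x => τ / x) x ∂halfGaussian := by
    refine integral_mono ((hi1.const_mul _).sub (hi2.const_mul _)) hi3 fun x => ?_
    by_cases hx : x ∈ Ioi (13 / 8 : ℝ)
    · have hx0 : (0 : ℝ) < x := lt_trans (by norm_num) (mem_Ioi.1 hx)
      simp only [indicator_of_mem hx, Pi.one_apply, one_mul]
      have e : b x * (τ / x) - (2 * p * b x - p ^ 2 / τ * x) =
          b x * ((τ - p * x) ^ 2 / (τ * x)) + (1 - b x) * (p ^ 2 / τ * x) := by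
        field_simp
        ring
      have h1 : 0 ≤ b x * ((τ - p * x) ^ 2 / (τ * x)) := mul_nonneg (hb0 x) (by positivity)
      have h2 : 0 ≤ (1 - b x) * (p ^ 2 / τ * x) :=
        mul_nonneg (sub_nonneg.2 (abs_le.1 (hb' x)).2) (by positivity)
      linarith
    · simp [hx]
  rw [integral_sub (hi1.const_mul _) (hi2.const_mul _), integral_const_mul, integral_const_mul,
    integral_indicator measurableSet_Ioi, setIntegral_id_halfGaussian (by norm_num), ← hp, ← hτ,
    div_mul_cancel₀ _ hτ0.ne'] at h
  linarith

theorem integrable_mul_chargeDensity {b : ℝ → ℝ} (hb : AEStronglyMeasurable b halfGaussian)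
    (hb' : ∀ x, |b x| ≤ 1) :
    Integrable (fun x => b x * ramp x) halfGaussian ∧
    Integrable (fun x => b x * ∫ y, crossKernel x y ∂halfGaussian) halfGaussian ∧
    Integrable (fun x => b x *
      (Ioi (13 / 8)).indicator (fun x => Real.exp (-(13 / 8) ^ 2 / 2) / x) x) halfGaussian := by
  refine ⟨integrable_ramp.bdd_mul hb (ae_of_all _ hb'), Integrable.bdd_mul ?_ hb (ae_of_all _ hb'),
    Integrable.bdd_mul ?_ hb (ae_of_all _ hb')⟩
  · have h : Integrable (fun p : ℝ × ℝ => crossKernel p.1 p.2)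
        (halfGaussian.prod halfGaussian) :=
      Integrable.of_bound measurable_crossKernel.aestronglyMeasurable 1
        (ae_of_all _ fun p => abs_crossKernel_le_one _ _)
    exact h.integral_prod_left
  · refine Integrable.of_bound (Measurable.indicator (by fun_prop)
      measurableSet_Ioi).aestronglyMeasurable 1 (ae_of_all _ fun x => ?_)
    by_cases hx : x ∈ Ioi (13 / 8 : ℝ)
    · have hx1 : (1 : ℝ) ≤ x := le_trans (by norm_num) (le_of_lt hx)
      rw [indicator_of_mem hx, Real.norm_of_nonneg (by positivity)]
      exact (div_le_self (Real.exp_pos _).le hx1).trans (by linarith [exp_tail_lt])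
    · simp [hx]

theorem integral_mul_chargeDensity {b : ℝ → ℝ} (hb : AEStronglyMeasurable b halfGaussian)
    (hb' : ∀ x, |b x| ≤ 1) :
    ∫ x, b x * chargeDensity x ∂halfGaussian =
      (∫ y, ramp y ∂halfGaussian) / 2 * ∫ x, b x * ramp x ∂halfGaussian +
      ∫ x, b x * ∫ y, crossKernel x y ∂halfGaussian ∂halfGaussian -
      ∫ x, b x * (Ioi (13 / 8)).indicator (fun x => Real.exp (-(13 / 8) ^ 2 / 2) / x) x
        ∂halfGaussian := by
  obtain ⟨h1, h2, h3⟩ := integrable_mul_chargeDensity hb hb'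
  have h12 : Integrable (fun x => (∫ y, ramp y ∂halfGaussian) / 2 * (b x * ramp x) +
      b x * ∫ y, crossKernel x y ∂halfGaussian) halfGaussian := (h1.const_mul _).add h2
  rw [← integral_const_mul, ← integral_add (h1.const_mul _) h2, ← integral_sub h12 h3]
  refine integral_congr_ae (ae_of_all _ fun x => ?_)
  simp only [chargeDensity]
  ring

/-- Integrating the pointwise minorant leaves only two bilinear terms, -2αβ from the ramp and -2pq
from the tails. The hypothesis on α + β and the tail estimate make both linear in a and c. -/
theorem integral_chargeDensity_le {a c : ℝ → ℝ} (ham : AEStronglyMeasurable a halfGaussian)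
    (hcm : AEStronglyMeasurable c halfGaussian) (ha : ∀ x, a x = 0 ∨ a x = 1)
    (hc : ∀ x, c x = 0 ∨ c x = 1)
    (h : ∫ x, a x * ramp x ∂halfGaussian + ∫ x, c x * ramp x ∂halfGaussian ≤
      ∫ x, ramp x ∂halfGaussian) :
    ∫ x, a x * chargeDensity x ∂halfGaussian + ∫ x, c x * chargeDensity x ∂halfGaussian ≤
      ∫ z, (a z.1 + c z.2 - 2 * (a z.1 * c z.2)) * Real.sin (z.1 * z.2)
        ∂(halfGaussian.prod halfGaussian) := by
  have ha1 : ∀ x, |a x| ≤ 1 := fun x => by rcases ha x with h | h <;> simp [h]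
  have hc1 : ∀ x, |c x| ≤ 1 := fun x => by rcases hc x with h | h <;> simp [h]
  have ha0 : ∀ x, 0 ≤ a x := fun x => by rcases ha x with h | h <;> simp [h]
  have hc0 : ∀ x, 0 ≤ c x := fun x => by rcases hc x with h | h <;> simp [h]
  set ν := halfGaussian.prod halfGaussian with hν
  set i1 : ℝ → ℝ := (Ioi (13 / 8)).indicator 1 with hi1
  have hi1m : Measurable i1 := measurable_one.indicator measurableSet_Ioi
  have hi1b : ∀ x, |i1 x| ≤ 1 := fun x => by
    by_cases hx : x ∈ Ioi (13 / 8 : ℝ) <;> simp [hi1, hx]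
  obtain ⟨ia1, ia2, ia3⟩ := integrable_mul_chargeDensity ham ha1
  obtain ⟨ic1, ic2, ic3⟩ := integrable_mul_chargeDensity hcm hc1
  have ia4 : Integrable (fun x => i1 x * a x) halfGaussian :=
    (Integrable.of_bound ham 1 (ae_of_all _ ha1)).bdd_mul hi1m.aestronglyMeasurable
      (ae_of_all _ hi1b)
  have ic4 : Integrable (fun x => i1 x * c x) halfGaussian :=
    (Integrable.of_bound hcm 1 (ae_of_all _ hc1)).bdd_mul hi1m.aestronglyMeasurable
      (ae_of_all _ hi1b)
  have ham1 : AEStronglyMeasurable (fun z : ℝ × ℝ => a z.1) ν := ham.comp_fst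
  have hcm2 : AEStronglyMeasurable (fun z : ℝ × ℝ => c z.2) ν := hcm.comp_snd
  have hcm1 : AEStronglyMeasurable (fun z : ℝ × ℝ => c z.1) ν := hcm.comp_fst
  have hk : Integrable (fun z : ℝ × ℝ => crossKernel z.1 z.2) ν :=
    Integrable.of_bound measurable_crossKernel.aestronglyMeasurable 1
      (ae_of_all _ fun p => abs_crossKernel_le_one _ _)
  have j1 : Integrable (fun z : ℝ × ℝ => a z.1 * ramp z.1 * ramp z.2) ν :=
    ia1.mul_prod integrable_ramp
  have j2 : Integrable (fun z : ℝ × ℝ => ramp z.1 * (c z.2 * ramp z.2)) ν :=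
    integrable_ramp.mul_prod ic1
  have j3 : Integrable (fun z : ℝ × ℝ => a z.1 * ramp z.1 * (c z.2 * ramp z.2)) ν :=
    ia1.mul_prod ic1
  have j4 : Integrable (fun z : ℝ × ℝ => i1 z.1 * a z.1 * (i1 z.2 * c z.2)) ν :=
    ia4.mul_prod ic4
  have j5 : Integrable (fun z : ℝ × ℝ => a z.1 * crossKernel z.1 z.2) ν :=
    hk.bdd_mul ham1 (ae_of_all _ fun z => ha1 z.1)
  have j6' : Integrable (fun z : ℝ × ℝ => c z.1 * crossKernel z.1 z.2) ν :=
    hk.bdd_mul hcm1 (ae_of_all _ fun z => hc1 z.1)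
  have j6 : Integrable (fun z : ℝ × ℝ => c z.2 * crossKernel z.2 z.1) ν := j6'.swap
  have e5 : ∫ z, a z.1 * crossKernel z.1 z.2 ∂ν =
      ∫ x, a x * ∫ y, crossKernel x y ∂halfGaussian ∂halfGaussian := by
    rw [integral_prod _ j5]
    simp only [integral_const_mul]
  have e6 : ∫ z, c z.2 * crossKernel z.2 z.1 ∂ν =
      ∫ x, c x * ∫ y, crossKernel x y ∂halfGaussian ∂halfGaussian := by
    rw [integral_prod_symm _ j6]
    simp only [integral_const_mul]
  have j12 : Integrable (fun z : ℝ × ℝ =>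
      a z.1 * ramp z.1 * ramp z.2 + ramp z.1 * (c z.2 * ramp z.2)) ν := j1.add j2
  have j123 : Integrable (fun z : ℝ × ℝ => a z.1 * ramp z.1 * ramp z.2 +
      ramp z.1 * (c z.2 * ramp z.2) - 2 * (a z.1 * ramp z.1 * (c z.2 * ramp z.2))) ν :=
    j12.sub (j3.const_mul 2)
  have j56 : Integrable (fun z : ℝ × ℝ =>
      a z.1 * crossKernel z.1 z.2 + c z.2 * crossKernel z.2 z.1) ν := j5.add j6
  have j456 : Integrable (fun z : ℝ × ℝ => a z.1 * crossKernel z.1 z.2 +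
      c z.2 * crossKernel z.2 z.1 - 2 * (i1 z.1 * a z.1 * (i1 z.2 * c z.2))) ν :=
    j56.sub (j4.const_mul 2)
  have hlow : ∫ z, ((a z.1 * ramp z.1 * ramp z.2 + ramp z.1 * (c z.2 * ramp z.2) -
      2 * (a z.1 * ramp z.1 * (c z.2 * ramp z.2))) +
      (a z.1 * crossKernel z.1 z.2 + c z.2 * crossKernel z.2 z.1 -
      2 * (i1 z.1 * a z.1 * (i1 z.2 * c z.2)))) ∂ν ≤
      ∫ z, (a z.1 + c z.2 - 2 * (a z.1 * c z.2)) * Real.sin (z.1 * z.2) ∂ν := by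
    refine integral_mono_ae (j123.add j456) ?_ ?_
    · refine Integrable.of_bound (((ham1.add hcm2).sub ((ham1.mul hcm2).const_mul 2)).mul
        (by fun_prop)) 1 (ae_of_all _ fun z => ?_)
      have := Real.abs_sin_le_one (z.1 * z.2)
      rcases ha z.1 with h1 | h1 <;> rcases hc z.2 with h2 | h2 <;> norm_num [h1, h2, this]
    · have hp1 : ∀ᵐ z ∂ν, 0 < z.1 := Measure.quasiMeasurePreserving_fst.ae ae_pos_halfGaussian
      have hp2 : ∀ᵐ z ∂ν, 0 < z.2 := Measure.quasiMeasurePreserving_snd.ae ae_pos_halfGaussian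
      filter_upwards [hp1, hp2] with z h1 h2
      refine le_trans (le_of_eq ?_) (disagreement_mul_sin_ge h1 h2 (ha z.1) (hc z.2))
      ring
  rw [integral_add j123 j456, integral_sub j12 (j3.const_mul 2), integral_add j1 j2,
    integral_const_mul, integral_sub j56 (j4.const_mul 2), integral_add j5 j6, integral_const_mul, e5, e6,
    integral_prod_mul (fun x => a x * ramp x) ramp,
    integral_prod_mul ramp (fun x => c x * ramp x),
    integral_prod_mul (fun x => a x * ramp x) (fun x => c x * ramp x),
    integral_prod_mul (fun x => i1 x * a x) (fun x => i1 x * c x)] at hlow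
  rw [integral_mul_chargeDensity ham ha1, integral_mul_chargeDensity hcm hc1]
  have s1 := sq_integral_tail_le ham ha1 ha0
  have s2 := sq_integral_tail_le hcm hc1 hc0
  rw [← hi1] at s1 s2
  have hα : 0 ≤ ∫ x, a x * ramp x ∂halfGaussian :=
    integral_nonneg fun x => mul_nonneg (ha0 x) (ramp_nonneg x)
  have hβ : 0 ≤ ∫ x, c x * ramp x ∂halfGaussian :=
    integral_nonneg fun x => mul_nonneg (hc0 x) (ramp_nonneg x)
  generalize ∫ x, a x * ramp x ∂halfGaussian = α at *
  generalize ∫ x, c x * ramp x ∂halfGaussian = β at *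
  generalize ∫ x, ramp x ∂halfGaussian = Φ at *
  generalize ∫ x, i1 x * a x ∂halfGaussian = p at *
  generalize ∫ x, i1 x * c x ∂halfGaussian = q at *
  -- Then 2αβ ≤ (α + β)²/2 ≤ Φ(α + β)/2, while 2pq ≤ p² + q² is absorbed by `s1` and `s2`.
  have k1 : (α + β) * (α + β) ≤ Φ * (α + β) := mul_le_mul_of_nonneg_right h (by positivity)
  linarith [sq_nonneg (p - q), sq_nonneg (α - β)]

/-- The bilinear form with kernel `sin (x y)` on the half-line Gaussian. -/
noncomputable def sineForm (u v : ℝ → ℝ) : ℝ :=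
  ∫ z, u z.1 * v z.2 * Real.sin (z.1 * z.2) ∂(halfGaussian.prod halfGaussian)

theorem integrable_sineForm {u v : ℝ → ℝ} (hu : AEStronglyMeasurable u halfGaussian)
    (hv : AEStronglyMeasurable v halfGaussian) {C : ℝ} (hu' : ∀ x, |u x| ≤ C)
    (hv' : ∀ x, |v x| ≤ C) :
    Integrable (fun z : ℝ × ℝ => u z.1 * v z.2 * Real.sin (z.1 * z.2))
      (halfGaussian.prod halfGaussian) := by
  refine Integrable.of_bound ((hu.comp_fst.mul hv.comp_snd).mul (by fun_prop)) (C * C * 1)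
    (ae_of_all _ fun z => ?_)
  have hC : 0 ≤ C := (abs_nonneg _).trans (hu' 0)
  rw [norm_mul, norm_mul]
  exact mul_le_mul (mul_le_mul (hu' _) (hv' _) (abs_nonneg _) hC) (Real.abs_sin_le_one _)
    (abs_nonneg _) (mul_nonneg hC hC)

theorem sineForm_one_one : sineForm 1 1 = √2 / 2 * Real.log (1 + √2) := by
  have h := integrable_sineForm (u := 1) (v := 1) (C := 1) aestronglyMeasurable_one
    aestronglyMeasurable_one (by simp) (by simp)
  rw [sineForm, integral_prod_symm _ h, ← integral_gaussSine]
  simp [gaussSine]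

theorem sineForm_neg_neg (u v : ℝ → ℝ) : sineForm (-u) (-v) = sineForm u v := by
  simp [sineForm]

/-- The sign condition is exactly α + β ≤ Φ for a = (1 - u)/2 and c = (1 - v)/2. In case of
equality, both integrals against the positive charge density vanish, so a and c vanish almost
everywhere. -/
theorem sineForm_le_of_nonneg {u v : ℝ → ℝ} (hum : AEStronglyMeasurable u halfGaussian)
    (hvm : AEStronglyMeasurable v halfGaussian) (hu : ∀ x, u x = -1 ∨ u x = 1)
    (hv : ∀ x, v x = -1 ∨ v x = 1)
    (h : 0 ≤ ∫ x, u x * ramp x ∂halfGaussian + ∫ x, v x * ramp x ∂halfGaussian) :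
    sineForm u v ≤ sineForm 1 1 ∧ (sineForm u v = sineForm 1 1 →
      (∀ᵐ x ∂halfGaussian, u x = 1) ∧ ∀ᵐ x ∂halfGaussian, v x = 1) := by
  have hu1 : ∀ x, |u x| ≤ 1 := fun x => by rcases hu x with h | h <;> simp [h]
  have hv1 : ∀ x, |v x| ≤ 1 := fun x => by rcases hv x with h | h <;> simp [h]
  have key : ∀ {w : ℝ → ℝ}, AEStronglyMeasurable w halfGaussian → (∀ x, w x = -1 ∨ w x = 1) →
      AEStronglyMeasurable (fun x => (1 - w x) / 2) halfGaussian ∧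
      (∀ x, (1 - w x) / 2 = 0 ∨ (1 - w x) / 2 = 1) ∧
      ∫ x, (1 - w x) / 2 * ramp x ∂halfGaussian =
        (∫ x, ramp x ∂halfGaussian) / 2 - (∫ x, w x * ramp x ∂halfGaussian) / 2 ∧
      0 ≤ ∫ x, (1 - w x) / 2 * chargeDensity x ∂halfGaussian ∧
      (∫ x, (1 - w x) / 2 * chargeDensity x ∂halfGaussian = 0 →
        ∀ᵐ x ∂halfGaussian, w x = 1) := by
    intro w hwm hw
    have hm : AEStronglyMeasurable (fun x => (1 - w x) / 2) halfGaussian := by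
      simp only [div_eq_mul_inv]
      exact (aestronglyMeasurable_const.sub hwm).mul_const _
    have hw01 : ∀ x, (1 - w x) / 2 = 0 ∨ (1 - w x) / 2 = 1 := fun x => by
      rcases hw x with h | h <;> norm_num [h]
    have hw1 : ∀ x, |w x| ≤ 1 := fun x => by rcases hw x with h | h <;> simp [h]
    have hb1 : ∀ x, |(1 - w x) / 2| ≤ 1 := fun x => by rcases hw01 x with h | h <;> simp [h]
    have hpos : 0 ≤ᵐ[halfGaussian] fun x => (1 - w x) / 2 * chargeDensity x := by
      filter_upwards [ae_pos_halfGaussian] with x hx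
      have := chargeDensity_pos hx
      rcases hw01 x with h | h <;> simp [h, this.le]
    refine ⟨hm, hw01, ?_, integral_nonneg_of_ae hpos, fun h0 => ?_⟩
    · have hi := (integrable_mul_chargeDensity hwm hw1).1
      rw [← sub_div, ← integral_sub integrable_ramp hi, ← integral_div]
      refine integral_congr_ae (ae_of_all _ fun x => ?_)
      simp only
      ring
    · obtain ⟨i1, i2, i3⟩ := integrable_mul_chargeDensity hm hb1
      have hi : Integrable (fun x => (1 - w x) / 2 * chargeDensity x) halfGaussian := by
        refine (((i1.const_mul ((∫ y, ramp y ∂halfGaussian) / 2)).add i2).sub i3).congr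
          (ae_of_all _ fun x => ?_)
        simp only [chargeDensity, Pi.add_apply, Pi.sub_apply]
        ring
      have := (integral_eq_zero_iff_of_nonneg_ae hpos hi).1 h0
      filter_upwards [this, ae_pos_halfGaussian] with x hx hx0
      have hc := chargeDensity_pos hx0
      rcases mul_eq_zero.1 hx with h | h
      · linarith
      · exact absurd h hc.ne'
  obtain ⟨am, a01, ai, ap, az⟩ := key hum hu
  obtain ⟨cm, c01, ci, cp, cz⟩ := key hvm hv
  have hmain := integral_chargeDensity_le am cm a01 c01 (by rw [ai, ci]; linarith)
  have e : ∫ z, ((1 - u z.1) / 2 + (1 - v z.2) / 2 -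
      2 * ((1 - u z.1) / 2 * ((1 - v z.2) / 2))) * Real.sin (z.1 * z.2)
      ∂(halfGaussian.prod halfGaussian) = (sineForm 1 1 - sineForm u v) / 2 := by
    rw [sineForm, sineForm, ← integral_sub (integrable_sineForm (C := 1) aestronglyMeasurable_one
      aestronglyMeasurable_one (by simp) (by simp)) (integrable_sineForm hum hvm hu1 hv1),
      ← integral_div]
    refine integral_congr_ae (ae_of_all _ fun z => ?_)
    simp only [Pi.one_apply]
    ring
  rw [e] at hmain
  exact ⟨by linarith, fun h => ⟨az (by linarith), cz (by linarith)⟩⟩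

/-- Negating both functions preserves the form and flips the sign condition, which therefore costs
no generality. -/
theorem sineForm_le {u v : ℝ → ℝ} (hum : AEStronglyMeasurable u halfGaussian)
    (hvm : AEStronglyMeasurable v halfGaussian) (hu : ∀ x, u x = -1 ∨ u x = 1)
    (hv : ∀ x, v x = -1 ∨ v x = 1) :
    sineForm u v ≤ sineForm 1 1 ∧ (sineForm u v = sineForm 1 1 →
      ((∀ᵐ x ∂halfGaussian, u x = 1) ∧ ∀ᵐ x ∂halfGaussian, v x = 1) ∨
      ((∀ᵐ x ∂halfGaussian, u x = -1) ∧ ∀ᵐ x ∂halfGaussian, v x = -1)) := by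
  rcases le_total 0 (∫ x, u x * ramp x ∂halfGaussian + ∫ x, v x * ramp x ∂halfGaussian) with h | h
  · have := sineForm_le_of_nonneg hum hvm hu hv h
    exact ⟨this.1, fun h => Or.inl (this.2 h)⟩
  · have flip : ∀ {w : ℝ → ℝ}, (∀ x, w x = -1 ∨ w x = 1) → ∀ x, (-w) x = -1 ∨ (-w) x = 1 :=
      fun hw x => by rcases hw x with h | h <;> simp [h]
    have := sineForm_le_of_nonneg hum.neg hvm.neg (flip hu) (flip hv) (by
      simp only [Pi.neg_apply, neg_mul, integral_neg]
      linarith)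
    rw [sineForm_neg_neg] at this
    refine ⟨this.1, fun h => Or.inr ?_⟩
    obtain ⟨h1, h2⟩ := this.2 h
    exact ⟨h1.mono fun x hx => by simpa using neg_eq_iff_eq_neg.1 hx,
      h2.mono fun x hx => by simpa using neg_eq_iff_eq_neg.1 hx⟩

end HalfLine

/-! ### Reduction from the line to the half-line -/

section Folding

open Set Filter Topology

theorem integral_eq_integral_Ioi_add_comp_neg {h : ℝ → ℝ} (hh : Integrable h) :
    ∫ x, h x = ∫ x in Ioi 0, (h x + h (-x)) := by
  have h1 := integral_comp_neg_Ioi (0 : ℝ) h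
  rw [neg_zero] at h1
  rw [integral_add hh.integrableOn hh.comp_neg.integrableOn, h1, add_comm]
  exact (intervalIntegral.integral_Iic_add_Ioi hh.integrableOn hh.integrableOn).symm

theorem integrable_exp_neg_sq_half : Integrable fun x : ℝ => Real.exp (-x ^ 2 / 2) := by
  refine (integrable_exp_neg_mul_sq (b := 1 / 2) (by norm_num)).congr (ae_of_all _ fun x => ?_)
  simp only
  congr 1
  ring

theorem oscKernel_eq (x y : ℝ) :
    oscKernel x y = Real.exp (-x ^ 2 / 2) * Real.exp (-y ^ 2 / 2) * Real.sin (x * y) := by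
  rw [oscKernel, ← Real.exp_add]
  congr 2
  ring

theorem oscIntegrable_of_bound {f g : ℝ → ℝ} (hf : AEStronglyMeasurable f)
    (hg : AEStronglyMeasurable g) (hf' : ∀ x, |f x| ≤ 1) (hg' : ∀ x, |g x| ≤ 1) :
    OscIntegrable f g := by
  have hm : AEStronglyMeasurable (fun p : ℝ × ℝ => f p.1 * g p.2 * Real.sin (p.1 * p.2))
      (volume.prod volume) := (hf.comp_fst.mul hg.comp_snd).mul (by fun_prop)
  refine ((integrable_exp_neg_sq_half.mul_prod integrable_exp_neg_sq_half).bdd_mul (c := 1) hm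
    (ae_of_all _ fun p => ?_)).congr (ae_of_all _ fun p => ?_)
  · rw [norm_mul, norm_mul]
    exact mul_le_one₀ (mul_le_one₀ (hf' _) (norm_nonneg _) (hg' _)) (norm_nonneg _)
      (Real.abs_sin_le_one _)
  · simp only [oscKernel_eq]
    ring

/-- The kernel is odd in each variable, so only the odd parts of f and g contribute. -/
theorem oscForm_eq_sineForm {f g : ℝ → ℝ} (hf : AEStronglyMeasurable f)
    (hg : AEStronglyMeasurable g) (hf' : ∀ x, |f x| ≤ 1) (hg' : ∀ x, |g x| ≤ 1) :
    oscForm f g = sineForm (fun x => f x + -f (-x)) (fun x => g x + -g (-x)) := by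
  have hq := (Measure.measurePreserving_neg (volume : Measure ℝ)).quasiMeasurePreserving
  have odd_meas : ∀ {h : ℝ → ℝ}, AEStronglyMeasurable h →
      AEStronglyMeasurable (fun x => h x + -h (-x)) halfGaussian := fun hh =>
    (hh.add (hh.comp_quasiMeasurePreserving hq).neg).mono_ac halfGaussian_absolutelyContinuous
  have odd_bound : ∀ {h : ℝ → ℝ}, (∀ x, |h x| ≤ 1) → ∀ x, |h x + -h (-x)| ≤ 2 := fun hh x => by
    have h1 := hh x
    have h2 := hh (-x)
    rw [abs_le] at *
    constructor <;> linarith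
  have hint := oscIntegrable_of_bound hf hg hf' hg'
  have inner : ∀ y, ∫ x, f x * g y * oscKernel x y = Real.exp (-y ^ 2 / 2) * (g y *
      ∫ x, (f x + -f (-x)) * Real.sin (x * y) ∂halfGaussian) := by
    intro y
    have hi : Integrable fun x => f x * g y * oscKernel x y := by
      refine (integrable_exp_neg_sq_half.bdd_mul (c := 1)
        (f := fun x => f x * (g y * Real.exp (-y ^ 2 / 2) * Real.sin (x * y)))
        (hf.mul (by fun_prop)) (ae_of_all _ fun x => ?_)).congr (ae_of_all _ fun x => ?_)
      · rw [norm_mul, norm_mul, norm_mul]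
        refine mul_le_one₀ (hf' _) (by positivity) (mul_le_one₀ (mul_le_one₀ (hg' _)
          (by positivity) ?_) (by positivity) (Real.abs_sin_le_one _))
        rw [Real.norm_of_nonneg (Real.exp_pos _).le, Real.exp_le_one_iff]
        linarith [sq_nonneg y]
      · simp only [oscKernel_eq]
        ring
    rw [integral_eq_integral_Ioi_add_comp_neg hi, integral_halfGaussian, ← integral_const_mul,
      ← integral_const_mul]
    refine integral_congr_ae (ae_of_all _ fun x => ?_)
    simp only [oscKernel_eq, neg_sq, neg_mul, Real.sin_neg]
    ring
  have houter : Integrable fun y => ∫ x, f x * g y * oscKernel x y := hint.integral_prod_right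
  rw [sineForm, integral_prod_symm _ (integrable_sineForm (odd_meas hf) (odd_meas hg)
    (odd_bound hf') (odd_bound hg')), oscForm, integral_eq_integral_Ioi_add_comp_neg houter,
    integral_halfGaussian]
  refine integral_congr_ae (ae_of_all _ fun y => ?_)
  have e1 : ∫ x, (f x + -f (-x)) * Real.sin (x * -y) ∂halfGaussian =
      -∫ x, (f x + -f (-x)) * Real.sin (x * y) ∂halfGaussian := by
    rw [← integral_neg]
    simp
  have e2 : ∫ x, (f x + -f (-x)) * (g y + -g (-y)) * Real.sin (x * y) ∂halfGaussian =
      (g y + -g (-y)) * ∫ x, (f x + -f (-x)) * Real.sin (x * y) ∂halfGaussian := by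
    rw [← integral_const_mul]
    refine integral_congr_ae (ae_of_all _ fun x => ?_)
    simp only
    ring
  simp only [inner, e1, e2, neg_sq]
  ring

/-- The odd parts take the value 0 as well as ±2; expanding bilinearly restores ±1-valued arguments,
to which the half-line bound applies. -/
theorem oscForm_eq_sum {f g : ℝ → ℝ} (hf : AEStronglyMeasurable f)
    (hg : AEStronglyMeasurable g) (hf' : ∀ x, |f x| ≤ 1) (hg' : ∀ x, |g x| ≤ 1) :
    oscForm f g = sineForm f g + sineForm (fun x => -f (-x)) g + sineForm f (fun x => -g (-x)) +
      sineForm (fun x => -f (-x)) (fun x => -g (-x)) := by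
  have hq := (Measure.measurePreserving_neg (volume : Measure ℝ)).quasiMeasurePreserving
  have m1 : ∀ {h : ℝ → ℝ}, AEStronglyMeasurable h → AEStronglyMeasurable h halfGaussian :=
    fun hh => hh.mono_ac halfGaussian_absolutelyContinuous
  have m2 : ∀ {h : ℝ → ℝ}, AEStronglyMeasurable h →
      AEStronglyMeasurable (fun x => -h (-x)) halfGaussian := fun hh =>
    m1 (hh.comp_quasiMeasurePreserving hq).neg
  have b2 : ∀ {h : ℝ → ℝ}, (∀ x, |h x| ≤ 1) → ∀ x, |-h (-x)| ≤ 1 := fun hh x => by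
    simpa using hh (-x)
  have i1 := integrable_sineForm (m1 hf) (m1 hg) hf' hg'
  have i2 := integrable_sineForm (m2 hf) (m1 hg) (b2 hf') hg'
  have i3 := integrable_sineForm (m1 hf) (m2 hg) hf' (b2 hg')
  have i4 := integrable_sineForm (m2 hf) (m2 hg) (b2 hf') (b2 hg')
  rw [oscForm_eq_sineForm hf hg hf' hg']
  unfold sineForm
  rw [← integral_add' i1 i2, ← integral_add' (i1.add i2) i3,
    ← integral_add' ((i1.add i2).add i3) i4]
  refine integral_congr_ae (ae_of_all _ fun z => ?_)
  simp only [Pi.add_apply]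
  ring

theorem sineForm_congr_ae {u v u' v' : ℝ → ℝ} (hu : ∀ᵐ x ∂halfGaussian, u x = u' x)
    (hv : ∀ᵐ x ∂halfGaussian, v x = v' x) : sineForm u v = sineForm u' v' := by
  refine integral_congr_ae ?_
  filter_upwards [Measure.quasiMeasurePreserving_fst.ae hu,
    Measure.quasiMeasurePreserving_snd.ae hv] with z h1 h2
  rw [h1, h2]

theorem oscForm_congr_ae {f g f' g' : ℝ → ℝ} (hf : ∀ᵐ x, f x = f' x) (hg : ∀ᵐ x, g x = g' x) :
    oscForm f g = oscForm f' g' := by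
  refine integral_congr_ae ?_
  filter_upwards [hg] with y hy
  refine integral_congr_ae ?_
  filter_upwards [hf] with x hx
  rw [hx, hy]

theorem abs_sign_le_one (x : ℝ) : |Real.sign x| ≤ 1 := by
  rcases Real.sign_apply_eq x with h | h | h <;> simp [h]

theorem aestronglyMeasurable_sign : AEStronglyMeasurable Real.sign := by
  refine Measurable.aestronglyMeasurable ?_
  unfold Real.sign
  exact Measurable.ite measurableSet_Iio measurable_const
    (Measurable.ite measurableSet_Ioi measurable_const measurable_const)

theorem oscForm_sign_sign : oscForm Real.sign Real.sign = 4 * sineForm 1 1 := by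
  have h1 : ∀ᵐ x ∂halfGaussian, Real.sign x = (1 : ℝ → ℝ) x := by
    filter_upwards [ae_pos_halfGaussian] with x hx
    simp [Real.sign_of_pos hx]
  have h2 : ∀ᵐ x ∂halfGaussian, -Real.sign (-x) = (1 : ℝ → ℝ) x := by
    filter_upwards [ae_pos_halfGaussian] with x hx
    simp [Real.sign_of_neg (neg_lt_zero.2 hx)]
  rw [oscForm_eq_sum aestronglyMeasurable_sign aestronglyMeasurable_sign abs_sign_le_one
    abs_sign_le_one, sineForm_congr_ae h1 h1, sineForm_congr_ae h1 h2, sineForm_congr_ae h2 h1,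
    sineForm_congr_ae h2 h2]
  ring

theorem ae_eq_mul_sign {h : ℝ → ℝ} {s : ℝ} (hp : ∀ᵐ x ∂halfGaussian, h x = s)
    (hn : ∀ᵐ x ∂halfGaussian, -h (-x) = s) : ∀ᵐ x ∂(volume : Measure ℝ), h x = s * Real.sign x := by
  have hq := (Measure.measurePreserving_neg (volume : Measure ℝ)).quasiMeasurePreserving
  have h0 : ∀ᵐ x ∂(volume : Measure ℝ), x ≠ 0 := by simp [ae_iff]
  filter_upwards [ae_halfGaussian_iff.1 hp, hq.ae (ae_halfGaussian_iff.1 hn), h0] with x h1 h2 h3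
  rcases lt_or_gt_of_ne h3 with hx | hx
  · have := h2 (neg_pos.2 hx)
    rw [neg_neg] at this
    rw [Real.sign_of_neg hx]
    linarith
  · rw [Real.sign_of_pos hx, mul_one]
    exact h1 hx

theorem not_ae_eq_of_ae_eq {h : ℝ → ℝ} {s t : ℝ} (hst : s ≠ t) (hs : ∀ᵐ x ∂halfGaussian, h x = s) :
    ¬∀ᵐ x ∂halfGaussian, h x = t := by
  intro ht
  have hf : ∀ᵐ _ ∂halfGaussian, False := by
    filter_upwards [hs, ht] with x h1 h2
    exact hst (h1.symm.trans h2)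
  have h0 : halfGaussian = 0 := by simpa using hf
  -- The positive integral of `ramp` rules out the zero measure.
  have := le_integral_ramp
  rw [h0] at this
  norm_num at this

end Folding

/-! ### The main theorem -/

theorem theorem1p3 :
    (OscIntegrable Real.sign Real.sign ∧
      oscForm Real.sign Real.sign = 2 * √2 * Real.log (1 + √2)) ∧
    ∀ f g : ℝ → ℝ, NullMeasurable f volume → NullMeasurable g volume →
      (∀ x, f x = -1 ∨ f x = 1) → (∀ x, g x = -1 ∨ g x = 1) →
      OscIntegrable f g ∧
      oscForm f g ≤ oscForm Real.sign Real.sign ∧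
      (oscForm f g = oscForm Real.sign Real.sign ↔
        ((∀ᵐ x ∂(volume : Measure ℝ), f x = Real.sign x) ∧
          (∀ᵐ x ∂(volume : Measure ℝ), g x = Real.sign x)) ∨
        ((∀ᵐ x ∂(volume : Measure ℝ), f x = -Real.sign x) ∧
          (∀ᵐ x ∂(volume : Measure ℝ), g x = -Real.sign x))) := by
  refine ⟨⟨oscIntegrable_of_bound aestronglyMeasurable_sign aestronglyMeasurable_sign
    abs_sign_le_one abs_sign_le_one, ?_⟩, ?_⟩
  · rw [oscForm_sign_sign, sineForm_one_one]
    ring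
  intro f g hfm hgm hf hg
  have hfm' : AEStronglyMeasurable f := hfm.aemeasurable.aestronglyMeasurable
  have hgm' : AEStronglyMeasurable g := hgm.aemeasurable.aestronglyMeasurable
  have abs_one : ∀ {h : ℝ → ℝ}, (∀ x, h x = -1 ∨ h x = 1) → ∀ x, |h x| ≤ 1 := fun hh x => by
    rcases hh x with h | h <;> simp [h]
  have hq := (Measure.measurePreserving_neg (volume : Measure ℝ)).quasiMeasurePreserving
  have m1 : ∀ {h : ℝ → ℝ}, AEStronglyMeasurable h → AEStronglyMeasurable h halfGaussian :=
    fun hh => hh.mono_ac halfGaussian_absolutelyContinuous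
  have m2 : ∀ {h : ℝ → ℝ}, AEStronglyMeasurable h →
      AEStronglyMeasurable (fun x => -h (-x)) halfGaussian := fun hh =>
    m1 (hh.comp_quasiMeasurePreserving hq).neg
  have v2 : ∀ {h : ℝ → ℝ}, (∀ x, h x = -1 ∨ h x = 1) → ∀ x, -h (-x) = -1 ∨ -h (-x) = 1 :=
    fun hh x => by rcases hh (-x) with h | h <;> simp [h]
  have B1 := sineForm_le (m1 hfm') (m1 hgm') hf hg
  have B2 := sineForm_le (m2 hfm') (m1 hgm') (v2 hf) hg
  have B3 := sineForm_le (m1 hfm') (m2 hgm') hf (v2 hg)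
  have B4 := sineForm_le (m2 hfm') (m2 hgm') (v2 hf) (v2 hg)
  have hsum := oscForm_eq_sum hfm' hgm' (abs_one hf) (abs_one hg)
  refine ⟨oscIntegrable_of_bound hfm' hgm' (abs_one hf) (abs_one hg), ?_, fun h => ?_, ?_⟩
  · rw [oscForm_sign_sign]
    linarith [B1.1, B2.1, B3.1, B4.1]
  · rw [oscForm_sign_sign] at h
    -- Four terms, each at most `sineForm 1 1`, sum to four times it, so each is extremal.
    have e1 := B1.2 (by linarith [B1.1, B2.1, B3.1, B4.1])
    have e2 := B2.2 (by linarith [B1.1, B2.1, B3.1, B4.1])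
    have e3 := B3.2 (by linarith [B1.1, B2.1, B3.1, B4.1])
    -- The second pair shares g with the first and the third shares f, so the sign chosen by the
    -- first pair propagates to the reflected functions.
    rcases e1 with ⟨hf1, hg1⟩ | ⟨hf1, hg1⟩
    · have hfn := (e2.resolve_right fun h =>
        not_ae_eq_of_ae_eq (by norm_num) h.2 hg1).1
      have hgn := (e3.resolve_right fun h =>
        not_ae_eq_of_ae_eq (by norm_num) h.1 hf1).2
      exact Or.inl ⟨by simpa using ae_eq_mul_sign hf1 hfn, by simpa using ae_eq_mul_sign hg1 hgn⟩
    · have hfn := (e2.resolve_left fun h =>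
        not_ae_eq_of_ae_eq (by norm_num) h.2 hg1).1
      have hgn := (e3.resolve_left fun h =>
        not_ae_eq_of_ae_eq (by norm_num) h.1 hf1).2
      exact Or.inr ⟨by simpa using ae_eq_mul_sign hf1 hfn, by simpa using ae_eq_mul_sign hg1 hgn⟩
  · rintro (⟨h1, h2⟩ | ⟨h1, h2⟩)
    · exact oscForm_congr_ae h1 h2
    · rw [oscForm_congr_ae h1 h2]
      simp [oscForm]
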